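/- Let $d\in\mathbb N$ and $n,m\ge 1$, let $x_1,\dots,x_n,\,y_1,\dots,y_m\in\mathbb R^d$, let $a_i>0$ and $b_j>0$ with $\sum_{i=1}^n a_i=\sum_{j=1}^m b_j=1$, and let $\gamma$ be a probability measure on $\mathbb R^d\times\mathbb R^d$ that is absolutely continuous with respect to Lebesgue measure. Write $\tilde\gamma(dx,dy)=\exp(-\tfrac12\|x\|^2-\tfrac12\|y\|^2)\,\gamma(dx,dy)$. For $(\alpha,\beta)\in\mathbb R^n\times\mathbb R^m$ and $\lambda>0$ put $$f(x,\alpha)=\max_{1\le i\le n}\{\langle x,x_i\rangle+\alpha_i\},\qquad g(y,\beta)=\max_{1\le j\le m}\{\langle y,y_j\rangle+\beta_j\},$$ $$\phi_\lambda(x,\alpha)=\Bigl(\sum_{i=1}^n e^{\lambda\langle x,x_i\rangle+\lambda\alpha_i}\Bigr)^{1/\lambda},\qquad \psi_\lambda(y,\beta)=\Bigl(\sum_{j=1}^m e^{\lambda\langle y,y_j\rangle+\lambda\beta_j}\Bigr)^{1/\lambda},$$ and define the dual objective of the semi-discrete problem and its regularization by $$U(\alpha,\beta)=\sum_{i=1}^n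 a_i\bigl(\alpha_i+\tfrac12\|x_i\|^2\bigr)+\sum_{j=1}^m b_j\bigl(\beta_j+\tfrac12\|y_j\|^2\bigr)-\int e^{f(x,\alpha)+g(y,\beta)}\,d\tilde\gamma+1,$$ $$U_\lambda(\alpha,\beta)=\sum_{i=1}^n a_i\bigl(\alpha_i+\tfrac12\|x_i\|^2\bigr)+\sum_{j=1}^m b_j\bigl(\beta_j+\tfrac12\|y_j\|^2\bigr)-\int \phi_\lambda(x,\alpha)\,\psi_\lambda(y,\beta)\,d\tilde\gamma+1.$$ Write $(\alpha,\beta)\sim_\oplus(\alpha',\beta')$ if there is $r\in\mathbb R$ with $\alpha=\alpha'+r\mathbf 1$ and $\beta=\beta'-r\mathbf 1$, and let $\|(\alpha,\beta)\|_{l^\infty_\oplus}=\max_{i,j}|\alpha_i+\beta_j|$. An optimizer is a global maximizer over $\mathbb R^n\times\mathbb R^m$. Then: 1. For every $\lambda>0$, $U_\lambda$ has an optimizer $(\alpha^\lambda,\beta^\lambda)$, and it is unique modulo $\sim_\oplus$. 2. $U$ has an optimizer, and the $l^\infty_\oplus$-distance from $(\alpha^\lambda,\beta^\lambda)$ to the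 set of optimizers of $U$ tends to $0$ as $\lambda\to\infty$. 3. Suppose moreover that there is a connected open set $G\subseteq\mathbb R^d\times\mathbb R^d$ with $\gamma(G)=1$ and $\gamma(V)>0$ for every nonempty open $V\subseteq G$ (for instance, that $\gamma$ has a positive density). Then $U$ has an optimizer $(\alpha^*,\beta^*)$ that is unique modulo $\sim_\oplus$, and $$\lim_{\lambda\to\infty}\|(\alpha^\lambda,\beta^\lambda)-(\alpha^*,\beta^*)\|_{l^\infty_\oplus}=0.$$ -/

import Mathlib

open MeasureTheory Filter Topology

namespace SemiDiscrete

noncomputable section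

/-- The Euclidean space `ℝ^d`. -/
abbrev Euc (d : ℕ) : Type := EuclideanSpace ℝ (Fin d)

/-- Pairs of dual variables `(α, β) ∈ ℝ^n × ℝ^m = ℝ^{n+m}`. -/
abbrev Pot (n m : ℕ) : Type := (Fin n → ℝ) × (Fin m → ℝ)

/-- The equivalence relation `(α, β) ~_⊕ (α', β')`: there is `r` with `α = α' + r 1` and
`β = β' - r 1`. -/
def OplusEquiv {n m : ℕ} (p q : Pot n m) : Prop :=
  ∃ r : ℝ, (∀ i, p.1 i = q.1 i + r) ∧ (∀ j, p.2 j = q.2 j - r)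

/-- The norm `‖(α, β)‖_{l^∞_⊕} = ‖(α_i + β_j)_{i,j}‖_{l^∞}`, evaluated on a representative.
(The norm of a function on a finite index type is the supremum norm.) -/
def oplusNorm {n m : ℕ} (p : Pot n m) : ℝ :=
  ‖(fun ij : Fin n × Fin m => p.1 ij.1 + p.2 ij.2 : Fin n × Fin m → ℝ)‖

/-- The measure `exp(-‖x‖²/2 - ‖y‖²/2) γ(dx, dy)`. -/
def tilted {d : ℕ} (γ : Measure (Euc d × Euc d)) : Measure (Euc d × Euc d) :=
  γ.withDensity fun z => ENNReal.ofReal (Real.exp (-(1 / 2) * ‖z.1‖ ^ 2 - (1 / 2) * ‖z.2‖ ^ 2))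

/-- `sup_i (⟨u, x_i⟩ + α_i)`; this is `f(u, α)`, and with the points `y_j` it is `g(u, β)`. -/
def maxAffine {d k : ℕ} (x : Fin k → Euc d) (α : Fin k → ℝ) (u : Euc d) : ℝ :=
  ⨆ i, (inner ℝ u (x i) + α i)

/-- `(∑_i exp(l ⟨u, x_i⟩ + l α_i))^{1/l}`, the exponential of a scaled log-sum-exp; this is
`φ_l(u, α)`, and with the points `y_j` it is `ψ_l(u, β)`. -/
def softExp {d k : ℕ} (l : ℝ) (x : Fin k → Euc d) (α : Fin k → ℝ) (u : Euc d) : ℝ :=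
  (∑ i, Real.exp (l * inner ℝ u (x i) + l * α i)) ^ (1 / l)

/-- The linear part `∑ a_i (α_i + ‖x_i‖²/2) + ∑ b_j (β_j + ‖y_j‖²/2)` of the dual objectives. -/
def linearPart {d n m : ℕ} (a : Fin n → ℝ) (b : Fin m → ℝ) (x : Fin n → Euc d)
    (y : Fin m → Euc d) (p : Pot n m) : ℝ :=
  ∑ i, a i * (p.1 i + 1 / 2 * ‖x i‖ ^ 2) + ∑ j, b j * (p.2 j + 1 / 2 * ‖y j‖ ^ 2)

/-- The semi-discrete dual objective `U`. -/
def dualU {d n m : ℕ} (a : Fin n → ℝ) (b : Fin m → ℝ) (x : Fin n → Euc d)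
    (y : Fin m → Euc d) (γ : Measure (Euc d × Euc d)) (p : Pot n m) : ℝ :=
  linearPart a b x y p
    - ∫ z, Real.exp (maxAffine x p.1 z.1 + maxAffine y p.2 z.2) ∂(tilted γ) + 1

/-- The regularized dual objective `U_l`. -/
def dualUReg {d n m : ℕ} (l : ℝ) (a : Fin n → ℝ) (b : Fin m → ℝ) (x : Fin n → Euc d)
    (y : Fin m → Euc d) (γ : Measure (Euc d × Euc d)) (p : Pot n m) : ℝ :=
  linearPart a b x y p - ∫ z, softExp l x p.1 z.1 * softExp l y p.2 z.2 ∂(tilted γ) + 1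

/-- `p` maximizes `F` over all of `ℝ^{n+m}`. -/
def IsOptimizer {n m : ℕ} (F : Pot n m → ℝ) (p : Pot n m) : Prop := ∀ q, F q ≤ F p

/-- `F` has a unique optimizer modulo `~_⊕`: its optimizers form exactly one `~_⊕`-class. -/
def HasUniqueOptimizer {n m : ℕ} (F : Pot n m → ℝ) : Prop :=
  ∃ p, ∀ q, IsOptimizer F q ↔ OplusEquiv q p

/-- `γ` lives on a connected open set, every nonempty open subset of which it charges. -/
def HasConnectedOpenCarrier {d : ℕ} (γ : Measure (Euc d × Euc d)) : Prop :=
  ∃ G : Set (Euc d × Euc d), IsOpen G ∧ IsConnected G ∧ γ Gᶜ = 0 ∧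
    ∀ V ⊆ G, IsOpen V → V.Nonempty → 0 < γ V

end

end SemiDiscrete

open SemiDiscrete

namespace SemiDiscrete

section MaxAffine

variable {d k : ℕ} (x : Fin k → Euc d) (α : Fin k → ℝ) (u : Euc d)

lemma le_maxAffine (i : Fin k) : inner ℝ u (x i) + α i ≤ maxAffine x α u :=
  le_ciSup (f := fun i => inner ℝ u (x i) + α i) (Set.finite_range _).bddAbove i

lemma exists_maxAffine_eq [Nonempty (Fin k)] :
    ∃ i, inner ℝ u (x i) + α i = maxAffine x α u :=
  exists_eq_ciSup_of_finite (f := fun i => inner ℝ u (x i) + α i)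

variable {x α u} in
lemma maxAffine_le [Nonempty (Fin k)] {c : ℝ} (h : ∀ i, inner ℝ u (x i) + α i ≤ c) :
    maxAffine x α u ≤ c :=
  ciSup_le h

lemma continuous_maxAffine [Nonempty (Fin k)] :
    Continuous fun q : (Fin k → ℝ) × Euc d => maxAffine x q.1 q.2 := by
  have : (fun q : (Fin k → ℝ) × Euc d => maxAffine x q.1 q.2) = fun q =>
      Finset.univ.sup' Finset.univ_nonempty fun i => inner ℝ q.2 (x i) + q.1 i := by
    ext q
    rw [Finset.sup'_univ_eq_ciSup]
    rfl
  rw [this]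
  refine Continuous.finset_sup'_apply _ fun i _ => ?_
  fun_prop

lemma maxAffine_add_const [Nonempty (Fin k)] (r : ℝ) :
    maxAffine x (fun i => α i + r) u = maxAffine x α u + r := by
  apply le_antisymm
  · refine maxAffine_le fun i => ?_
    linarith [le_maxAffine x α u i]
  · obtain ⟨i, hi⟩ := exists_maxAffine_eq x α u
    linarith [le_maxAffine x (fun i => α i + r) u i]

lemma maxAffine_midpoint_le [Nonempty (Fin k)] (α' : Fin k → ℝ) :
    maxAffine x (fun i => (α i + α' i) / 2) u ≤ (maxAffine x α u + maxAffine x α' u) / 2 := by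
  refine maxAffine_le fun i => ?_
  linarith [le_maxAffine x α u i, le_maxAffine x α' u i]

lemma maxAffine_max [Nonempty (Fin k)] (α' : Fin k → ℝ) :
    maxAffine x (fun i => max (α i) (α' i)) u = max (maxAffine x α u) (maxAffine x α' u) := by
  apply le_antisymm
  · refine maxAffine_le fun i => ?_
    rw [← max_add_add_left]
    exact max_le_max (le_maxAffine x α u i) (le_maxAffine x α' u i)
  · have h := le_maxAffine x (fun i => max (α i) (α' i)) u
    refine max_le (maxAffine_le fun i => ?_) (maxAffine_le fun i => ?_)
    · linarith [h i, le_max_left (α i) (α' i)]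
    · linarith [h i, le_max_right (α i) (α' i)]

variable {x} in
lemma abs_inner_le_of_norm_le {R : ℝ} (hR : ∀ i, ‖x i‖ ≤ R) (i : Fin k) :
    |inner ℝ u (x i)| ≤ R * ‖u‖ := by
  refine (abs_real_inner_le_norm u (x i)).trans ?_
  rw [mul_comm]
  exact mul_le_mul_of_nonneg_right (hR i) (norm_nonneg u)

variable {x} in
lemma maxAffine_le_norm [Nonempty (Fin k)] {R : ℝ} (hR : ∀ i, ‖x i‖ ≤ R) :
    maxAffine x α u ≤ R * ‖u‖ + ‖α‖ := by
  refine maxAffine_le fun i => ?_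
  have h1 := (abs_le.1 (abs_inner_le_of_norm_le u hR i)).2
  have h2 := (le_abs_self _).trans (norm_le_pi_norm α i)
  linarith

variable {x} in
lemma sub_le_maxAffine {R : ℝ} (hR : ∀ i, ‖x i‖ ≤ R) (i : Fin k) :
    α i - R * ‖u‖ ≤ maxAffine x α u := by
  have h1 := (abs_le.1 (abs_inner_le_of_norm_le u hR i)).1
  linarith [le_maxAffine x α u i]

end MaxAffine

section SoftExp

variable {d k : ℕ} {l : ℝ} (x : Fin k → Euc d) (α : Fin k → ℝ) (u : Euc d)

lemma sum_exp_pos [Nonempty (Fin k)] :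
    0 < ∑ i, Real.exp (l * inner ℝ u (x i) + l * α i) :=
  Finset.sum_pos (fun _ _ => Real.exp_pos _) Finset.univ_nonempty

lemma softExp_pos [Nonempty (Fin k)] : 0 < softExp l x α u :=
  Real.rpow_pos_of_pos (sum_exp_pos x α u) _

lemma continuous_softExp [Nonempty (Fin k)] :
    Continuous fun q : (Fin k → ℝ) × Euc d => softExp l x q.1 q.2 := by
  unfold softExp
  refine Continuous.rpow_const ?_ fun q => Or.inl (sum_exp_pos x q.1 q.2).ne'
  fun_prop

lemma exp_mul_rpow_inv (hl : 0 < l) (t : ℝ) : Real.exp (l * t) ^ (1 / l) = Real.exp t := by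
  rw [← Real.exp_mul]
  congr 1
  field_simp

lemma exp_maxAffine_le_softExp [Nonempty (Fin k)] (hl : 0 < l) :
    Real.exp (maxAffine x α u) ≤ softExp l x α u := by
  obtain ⟨i, hi⟩ := exists_maxAffine_eq x α u
  rw [← exp_mul_rpow_inv hl]
  refine Real.rpow_le_rpow (Real.exp_pos _).le ?_ (by positivity)
  rw [← hi, mul_add]
  exact Finset.single_le_sum (f := fun i => Real.exp (l * inner ℝ u (x i) + l * α i))
    (fun _ _ => (Real.exp_pos _).le) (Finset.mem_univ i)

lemma softExp_le_exp_maxAffine [Nonempty (Fin k)] (hl : 0 < l) :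
    softExp l x α u ≤ (k : ℝ) ^ (1 / l) * Real.exp (maxAffine x α u) := by
  rw [← exp_mul_rpow_inv hl, ← Real.mul_rpow (by positivity) (Real.exp_pos _).le]
  refine Real.rpow_le_rpow (sum_exp_pos x α u).le ?_ (by positivity)
  refine (Finset.sum_le_card_nsmul _ _ (Real.exp (l * maxAffine x α u)) fun i _ => ?_).trans ?_
  · rw [← mul_add]
    exact Real.exp_le_exp.2 (mul_le_mul_of_nonneg_left (le_maxAffine x α u i) hl.le)
  · simp

lemma softExp_add_const [Nonempty (Fin k)] (hl : 0 < l) (r : ℝ) :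
    softExp l x (fun i => α i + r) u = softExp l x α u * Real.exp r := by
  rw [← exp_mul_rpow_inv hl r]
  unfold softExp
  rw [← Real.mul_rpow (sum_exp_pos x α u).le (Real.exp_pos _).le, Finset.sum_mul]
  congr 1
  refine Finset.sum_congr rfl fun i _ => ?_
  rw [← Real.exp_add]
  ring_nf

lemma exp_midpoint_sq (s t : ℝ) : Real.exp ((s + t) / 2) = Real.exp (s / 2) * Real.exp (t / 2) := by
  rw [← Real.exp_add]
  ring_nf

lemma exp_half_sq (s : ℝ) : Real.exp (s / 2) ^ 2 = Real.exp s := by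
  rw [← Real.exp_nat_mul]
  congr 1
  push_cast
  ring

lemma sum_exp_midpoint_sq_le {ι : Type*} [Fintype ι] (s t : ι → ℝ) :
    (∑ i, Real.exp ((s i + t i) / 2)) ^ 2 ≤ (∑ i, Real.exp (s i)) * ∑ i, Real.exp (t i) := by
  have := Finset.sum_mul_sq_le_sq_mul_sq Finset.univ
    (fun i => Real.exp (s i / 2)) (fun i => Real.exp (t i / 2))
  simpa only [exp_half_sq, ← exp_midpoint_sq] using this

/-- Equality in the Cauchy–Schwarz inequality for sums of exponentials. -/
lemma sub_eq_sub_of_sum_exp_midpoint {ι : Type*} [Fintype ι] (s t : ι → ℝ)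
    (h : (∑ i, Real.exp (s i)) * ∑ i, Real.exp (t i) ≤ (∑ i, Real.exp ((s i + t i) / 2)) ^ 2)
    (i j : ι) : s i - t i = s j - t j := by
  set A := ∑ i, Real.exp (s i)
  set B := ∑ i, Real.exp (t i)
  set C := ∑ i, Real.exp ((s i + t i) / 2)
  have hB : 0 < B := Finset.sum_pos (fun _ _ => Real.exp_pos _) ⟨i, Finset.mem_univ i⟩
  have hsum : ∑ i, (B * Real.exp (s i / 2) - C * Real.exp (t i / 2)) ^ 2
      = B * (A * B - C ^ 2) := by
    have : ∀ i, (B * Real.exp (s i / 2) - C * Real.exp (t i / 2)) ^ 2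
        = B ^ 2 * Real.exp (s i) - 2 * B * C * Real.exp ((s i + t i) / 2)
          + C ^ 2 * Real.exp (t i) := fun i => by
      rw [exp_midpoint_sq, ← exp_half_sq (s i), ← exp_half_sq (t i)]
      ring
    simp_rw [this]
    rw [Finset.sum_add_distrib, Finset.sum_sub_distrib, ← Finset.mul_sum, ← Finset.mul_sum,
      ← Finset.mul_sum]
    change B ^ 2 * A - 2 * B * C * C + C ^ 2 * B = _
    ring
  have hzero : ∑ i, (B * Real.exp (s i / 2) - C * Real.exp (t i / 2)) ^ 2 = 0 := by
    refine le_antisymm ?_ (Finset.sum_nonneg fun _ _ => sq_nonneg _)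
    rw [hsum]
    exact mul_nonpos_of_nonneg_of_nonpos hB.le (by linarith)
  have hprop : ∀ i, Real.exp ((s i - t i) / 2) = C / B := fun i => by
    have h0 := (Finset.sum_eq_zero_iff_of_nonneg fun _ _ => sq_nonneg _).1 hzero i
      (Finset.mem_univ i)
    have h1 := pow_eq_zero_iff (two_ne_zero) |>.1 h0
    rw [sub_div, Real.exp_sub, div_eq_div_iff (Real.exp_pos _).ne' hB.ne']
    linarith
  have := Real.exp_injective ((hprop i).trans (hprop j).symm)
  linarith

lemma rpow_inv_sq {S : ℝ} (hS : 0 ≤ S) (c : ℝ) : (S ^ c) ^ 2 = (S ^ 2) ^ c := by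
  rw [← Real.rpow_natCast, ← Real.rpow_natCast, ← Real.rpow_mul hS, ← Real.rpow_mul hS, mul_comm]

lemma sum_exp_midpoint_eq (α' : Fin k → ℝ) :
    ∑ i, Real.exp (l * inner ℝ u (x i) + l * ((α i + α' i) / 2)) =
      ∑ i, Real.exp (((l * inner ℝ u (x i) + l * α i) + (l * inner ℝ u (x i) + l * α' i)) / 2) :=
  Finset.sum_congr rfl fun i _ => by ring_nf

lemma softExp_midpoint_sq_le [Nonempty (Fin k)] (hl : 0 < l) (α' : Fin k → ℝ) :
    softExp l x (fun i => (α i + α' i) / 2) u ^ 2 ≤ softExp l x α u * softExp l x α' u := by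
  unfold softExp
  rw [rpow_inv_sq (sum_exp_pos x _ u).le,
    ← Real.mul_rpow (sum_exp_pos x _ u).le (sum_exp_pos x _ u).le]
  refine Real.rpow_le_rpow (sq_nonneg _) ?_ (by positivity)
  rw [sum_exp_midpoint_eq]
  exact sum_exp_midpoint_sq_le _ _

lemma sub_eq_sub_of_softExp_midpoint [Nonempty (Fin k)] (hl : 0 < l) (α' : Fin k → ℝ)
    (h : softExp l x α u * softExp l x α' u ≤ softExp l x (fun i => (α i + α' i) / 2) u ^ 2)
    (i j : Fin k) : α i - α' i = α j - α' j := by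
  unfold softExp at h
  rw [rpow_inv_sq (sum_exp_pos x _ u).le,
    ← Real.mul_rpow (sum_exp_pos x _ u).le (sum_exp_pos x _ u).le,
    Real.rpow_le_rpow_iff (mul_pos (sum_exp_pos x _ u) (sum_exp_pos x _ u)).le (sq_nonneg _)
      (by positivity), sum_exp_midpoint_eq] at h
  have := sub_eq_sub_of_sum_exp_midpoint _ _ h i j
  have h2 : l * ((α i - α' i) - (α j - α' j)) = 0 := by linarith
  have := (mul_eq_zero.1 h2).resolve_left hl.ne'
  linarith

end SoftExp

section Tilted

variable {d : ℕ} (γ : Measure (Euc d × Euc d))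

lemma ae_of_ae_tilted {P : Euc d × Euc d → Prop} (h : ∀ᵐ z ∂(tilted γ), P z) :
    ∀ᵐ z ∂γ, P z := by
  rw [tilted, ae_withDensity_iff (by fun_prop)] at h
  filter_upwards [h] with z hz
  exact hz (by simpa using Real.exp_pos _)

lemma tilted_ne_zero [IsProbabilityMeasure γ] : tilted γ ≠ 0 := by
  intro h
  have : ∀ᵐ z ∂(tilted γ), False := by simp [h]
  exact IsProbabilityMeasure.ne_zero γ (by simpa using ae_of_ae_tilted γ this)

lemma integrable_exp_norm_tilted [IsProbabilityMeasure γ] (R : ℝ) :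
    Integrable (fun z => Real.exp (R * (‖z.1‖ + ‖z.2‖))) (tilted γ) := by
  rw [tilted, integrable_withDensity_iff (by fun_prop) (by simp)]
  refine Integrable.mono' (integrable_const (Real.exp (R ^ 2))) (by fun_prop) ?_
  refine Eventually.of_forall fun z => ?_
  rw [ENNReal.toReal_ofReal (Real.exp_pos _).le, ← Real.exp_add, Real.norm_eq_abs,
    abs_of_pos (Real.exp_pos _)]
  refine Real.exp_le_exp.2 ?_
  nlinarith [sq_nonneg (‖z.1‖ - R), sq_nonneg (‖z.2‖ - R)]

end Tilted

/-- A continuous family of integrands of the size of `exp (f + g)`, invariant under `~_⊕`. -/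
structure IsAdmissible {d n m : ℕ} (x : Fin n → Euc d) (y : Fin m → Euc d)
    (F : Pot n m → Euc d × Euc d → ℝ) : Prop where
  continuous : Continuous fun q : Pot n m × (Euc d × Euc d) => F q.1 q.2
  exp_le : ∀ p z, Real.exp (maxAffine x p.1 z.1 + maxAffine y p.2 z.2) ≤ F p z
  exists_le : ∃ C, ∀ p z, F p z ≤ C * Real.exp (maxAffine x p.1 z.1 + maxAffine y p.2 z.2)
  congr : ∀ p q, OplusEquiv p q → ∀ z, F p z = F q z

lemma IsAdmissible.pos {d n m : ℕ} {x : Fin n → Euc d} {y : Fin m → Euc d}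
    {F : Pot n m → Euc d × Euc d → ℝ} (hF : IsAdmissible x y F) (p : Pot n m)
    (z : Euc d × Euc d) : 0 < F p z :=
  (Real.exp_pos _).trans_le (hF.exp_le p z)

lemma exists_norm_le {d n m : ℕ} {x : Fin n → Euc d} {y : Fin m → Euc d} :
    ∃ R : ℝ, (∀ i, ‖x i‖ ≤ R) ∧ ∀ j, ‖y j‖ ≤ R :=
  ⟨max ‖x‖ ‖y‖, fun i => (norm_le_pi_norm x i).trans (le_max_left _ _),
    fun j => (norm_le_pi_norm y j).trans (le_max_right _ _)⟩

section Integrands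

variable {d n m : ℕ} [Nonempty (Fin n)] [Nonempty (Fin m)]
  (x : Fin n → Euc d) (y : Fin m → Euc d)

lemma maxAffine_add_congr {p q : Pot n m} (h : OplusEquiv p q) (u v : Euc d) :
    maxAffine x p.1 u + maxAffine y p.2 v = maxAffine x q.1 u + maxAffine y q.2 v := by
  obtain ⟨r, h1, h2⟩ := h
  rw [show p.1 = fun i => q.1 i + r from funext h1,
    show p.2 = fun j => q.2 j + -r from funext fun j => by rw [h2 j]; ring,
    maxAffine_add_const, maxAffine_add_const]
  ring

lemma isAdmissible_exp : IsAdmissible x y fun p z =>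
    Real.exp (maxAffine x p.1 z.1 + maxAffine y p.2 z.2) where
  continuous := by
    have h1 := (continuous_maxAffine x).comp (f := fun q : Pot n m × (Euc d × Euc d) =>
      (q.1.1, q.2.1)) (by fun_prop)
    have h2 := (continuous_maxAffine y).comp (f := fun q : Pot n m × (Euc d × Euc d) =>
      (q.1.2, q.2.2)) (by fun_prop)
    exact Real.continuous_exp.comp (h1.add h2)
  exp_le _ _ := le_rfl
  exists_le := ⟨1, fun _ _ => (one_mul _).ge⟩
  congr p q h z := by rw [maxAffine_add_congr x y h]

variable {l : ℝ} in
lemma softExp_mul_le (hl : 0 < l) (p : Pot n m) (u v : Euc d) :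
    softExp l x p.1 u * softExp l y p.2 v ≤ (n : ℝ) ^ (1 / l) * (m : ℝ) ^ (1 / l) *
      Real.exp (maxAffine x p.1 u + maxAffine y p.2 v) := by
  rw [Real.exp_add, mul_mul_mul_comm]
  exact mul_le_mul (softExp_le_exp_maxAffine x p.1 u hl) (softExp_le_exp_maxAffine y p.2 v hl)
    (softExp_pos y p.2 v).le (by positivity)

variable {l : ℝ} in
lemma isAdmissible_softExp (hl : 0 < l) : IsAdmissible x y fun p z =>
    softExp l x p.1 z.1 * softExp l y p.2 z.2 where
  continuous := by
    have h1 := (continuous_softExp (l := l) x).comp (f := fun q : Pot n m × (Euc d × Euc d) =>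
      (q.1.1, q.2.1)) (by fun_prop)
    have h2 := (continuous_softExp (l := l) y).comp (f := fun q : Pot n m × (Euc d × Euc d) =>
      (q.1.2, q.2.2)) (by fun_prop)
    exact h1.mul h2
  exp_le p z := by
    rw [Real.exp_add]
    exact mul_le_mul (exp_maxAffine_le_softExp x p.1 z.1 hl)
      (exp_maxAffine_le_softExp y p.2 z.2 hl) (Real.exp_pos _).le (softExp_pos x p.1 z.1).le
  exists_le := ⟨_, fun p z => softExp_mul_le x y hl p z.1 z.2⟩
  congr p q h z := by
    obtain ⟨r, h1, h2⟩ := h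
    rw [show p.1 = fun i => q.1 i + r from funext h1,
      show p.2 = fun j => q.2 j + -r from funext fun j => by rw [h2 j]; ring,
      softExp_add_const x _ _ hl, softExp_add_const y _ _ hl, Real.exp_neg]
    field_simp

namespace IsAdmissible

variable {x y} {F : Pot n m → Euc d × Euc d → ℝ} (hF : IsAdmissible x y F)
include hF

lemma exists_bound (M : ℝ) : ∃ C R : ℝ, ∀ p : Pot n m, ‖p‖ ≤ M → ∀ z,
    ‖F p z‖ ≤ C * Real.exp (R * (‖z.1‖ + ‖z.2‖)) := by
  obtain ⟨C, hC⟩ := hF.exists_le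
  obtain ⟨R, hx, hy⟩ := exists_norm_le (x := x) (y := y)
  refine ⟨|C| * Real.exp (2 * M), R, fun p hp z => ?_⟩
  rw [Real.norm_eq_abs, abs_of_pos (hF.pos p z), mul_assoc, ← Real.exp_add]
  refine (hC p z).trans (mul_le_mul (le_abs_self C) (Real.exp_le_exp.2 ?_) (Real.exp_pos _).le
    (abs_nonneg C))
  have h1 := maxAffine_le_norm p.1 z.1 hx
  have h2 := maxAffine_le_norm p.2 z.2 hy
  have h3 := (norm_fst_le p).trans hp
  have h4 := (norm_snd_le p).trans hp
  linarith

variable (γ : Measure (Euc d × Euc d)) [IsProbabilityMeasure γ]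

lemma integrable (p : Pot n m) : Integrable (F p) (tilted γ) := by
  obtain ⟨C, R, h⟩ := hF.exists_bound ‖p‖
  exact Integrable.mono' ((integrable_exp_norm_tilted γ R).const_mul C)
    (hF.continuous.comp (Continuous.prodMk_right p)).aestronglyMeasurable
    (Eventually.of_forall (h p le_rfl))

lemma continuous_integral : Continuous fun p => ∫ z, F p z ∂(tilted γ) := by
  rw [continuous_iff_continuousAt]
  intro p
  obtain ⟨C, R, h⟩ := hF.exists_bound (‖p‖ + 1)
  refine continuousAt_of_dominated (bound := fun z => C * Real.exp (R * (‖z.1‖ + ‖z.2‖)))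
    (Eventually.of_forall fun q => (hF.integrable γ q).aestronglyMeasurable) ?_
    ((integrable_exp_norm_tilted γ R).const_mul C) (Eventually.of_forall fun z => ?_)
  · filter_upwards [continuous_norm.continuousAt.eventually_lt
      (continuousAt_const (y := ‖p‖ + 1)) (lt_add_one ‖p‖)] with q hq
    exact Eventually.of_forall (h q hq.le)
  · exact (hF.continuous.comp (Continuous.prodMk_left z)).continuousAt

end IsAdmissible

end Integrands

section Oplus

variable {n m : ℕ}

lemma OplusEquiv.oplusNorm_sub {p p' q q' : Pot n m} (hp : OplusEquiv p p')
    (hq : OplusEquiv q q') : oplusNorm (p - q) = oplusNorm (p' - q') := by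
  obtain ⟨r, h1, h2⟩ := hp
  obtain ⟨s, h3, h4⟩ := hq
  unfold oplusNorm
  congr 1
  ext ij
  simp only [Prod.fst_sub, Prod.snd_sub, Pi.sub_apply, h1, h2, h3, h4]
  ring

lemma OplusEquiv.refl (p : Pot n m) : OplusEquiv p p := ⟨0, by simp, by simp⟩

lemma continuous_oplusNorm : Continuous (oplusNorm : Pot n m → ℝ) := by
  unfold oplusNorm
  fun_prop

lemma oplusNorm_zero : oplusNorm (0 : Pot n m) = 0 := by
  simp [oplusNorm, ← Pi.zero_def]

lemma oplusNorm_nonneg (p : Pot n m) : 0 ≤ oplusNorm p := norm_nonneg _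

variable {d : ℕ} {a : Fin n → ℝ} {b : Fin m → ℝ} {x : Fin n → Euc d} {y : Fin m → Euc d}

lemma linearPart_congr (ha1 : ∑ i, a i = 1) (hb1 : ∑ j, b j = 1) {p q : Pot n m}
    (h : OplusEquiv p q) : linearPart a b x y p = linearPart a b x y q := by
  obtain ⟨r, h1, h2⟩ := h
  have e1 : ∑ i, a i * (p.1 i + 1 / 2 * ‖x i‖ ^ 2)
      = ∑ i, a i * (q.1 i + 1 / 2 * ‖x i‖ ^ 2) + r := by
    rw [← one_mul r, ← ha1, Finset.sum_mul, ← Finset.sum_add_distrib]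
    exact Finset.sum_congr rfl fun i _ => by rw [h1, ha1]; ring
  have e2 : ∑ j, b j * (p.2 j + 1 / 2 * ‖y j‖ ^ 2)
      = ∑ j, b j * (q.2 j + 1 / 2 * ‖y j‖ ^ 2) - r := by
    rw [← one_mul r, ← hb1, Finset.sum_mul, ← Finset.sum_sub_distrib]
    exact Finset.sum_congr rfl fun i _ => by rw [h2, hb1]; ring
  rw [linearPart, linearPart, e1, e2]
  ring

lemma continuous_linearPart : Continuous (linearPart a b x y) := by
  unfold linearPart
  fun_prop

/-- The coordinatewise midpoint. -/
noncomputable def midPot (p q : Pot n m) : Pot n m :=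
  (fun i => (p.1 i + q.1 i) / 2, fun j => (p.2 j + q.2 j) / 2)

lemma linearPart_midPot (p q : Pot n m) : linearPart a b x y (midPot p q)
    = (linearPart a b x y p + linearPart a b x y q) / 2 := by
  have e1 : ∑ i, a i * ((midPot p q).1 i + 1 / 2 * ‖x i‖ ^ 2)
      = (∑ i, a i * (p.1 i + 1 / 2 * ‖x i‖ ^ 2) + ∑ i, a i * (q.1 i + 1 / 2 * ‖x i‖ ^ 2)) / 2 := by
    rw [← Finset.sum_add_distrib, Finset.sum_div]
    exact Finset.sum_congr rfl fun i _ => by simp only [midPot]; ring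
  have e2 : ∑ i, b i * ((midPot p q).2 i + 1 / 2 * ‖y i‖ ^ 2)
      = (∑ i, b i * (p.2 i + 1 / 2 * ‖y i‖ ^ 2) + ∑ i, b i * (q.2 i + 1 / 2 * ‖y i‖ ^ 2)) / 2 := by
    rw [← Finset.sum_add_distrib, Finset.sum_div]
    exact Finset.sum_congr rfl fun i _ => by simp only [midPot]; ring
  rw [linearPart, linearPart, linearPart, e1, e2]
  ring

end Oplus

/-- The concave functional attached to a family of integrands. -/
noncomputable def dualFunctional {d n m : ℕ} (a : Fin n → ℝ) (b : Fin m → ℝ) (x : Fin n → Euc d)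
    (y : Fin m → Euc d) (γ : Measure (Euc d × Euc d)) (F : Pot n m → Euc d × Euc d → ℝ)
    (p : Pot n m) : ℝ :=
  linearPart a b x y p - ∫ z, F p z ∂(tilted γ) + 1

lemma exists_sub_mul_exp_le {c : ℝ} (hc : 0 < c) :
    ∃ C : ℝ, ∀ s : ℝ, s - c * Real.exp s ≤ C - |s| := by
  refine ⟨max 0 (-2 * Real.log (c / 2) - 2), fun s => ?_⟩
  have h0 := le_max_left 0 (-2 * Real.log (c / 2) - 2)
  have h1 := le_max_right 0 (-2 * Real.log (c / 2) - 2)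
  have hexp : c * Real.exp s = 2 * Real.exp (s + Real.log (c / 2)) := by
    rw [Real.exp_add, Real.exp_log (by positivity)]
    ring
  have h2 := Real.add_one_le_exp (s + Real.log (c / 2))
  have h3 : 0 < c * Real.exp s := by positivity
  rcases abs_cases s with ⟨h, -⟩ | ⟨h, -⟩ <;> rw [h] <;> linarith

section Existence

variable {d n m : ℕ} [Nonempty (Fin n)] [Nonempty (Fin m)]
  {a : Fin n → ℝ} {b : Fin m → ℝ} {x : Fin n → Euc d} {y : Fin m → Euc d}
  (γ : Measure (Euc d × Euc d)) [IsProbabilityMeasure γ]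
  {F : Pot n m → Euc d × Euc d → ℝ}

lemma exists_mul_exp_le_integral : ∃ c > 0, ∀ (p : Pot n m) i j, c * Real.exp (p.1 i + p.2 j) ≤
    ∫ z, Real.exp (maxAffine x p.1 z.1 + maxAffine y p.2 z.2) ∂(tilted γ) := by
  obtain ⟨R, hx, hy⟩ := exists_norm_le (x := x) (y := y)
  have : NeZero (tilted γ) := ⟨tilted_ne_zero γ⟩
  refine ⟨∫ z, Real.exp (-R * (‖z.1‖ + ‖z.2‖)) ∂(tilted γ),
    integral_exp_pos (integrable_exp_norm_tilted γ (-R)), fun p i j => ?_⟩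
  rw [← integral_mul_const]
  refine integral_mono ((integrable_exp_norm_tilted γ (-R)).mul_const _)
    ((isAdmissible_exp x y).integrable γ p) fun z => ?_
  simp only
  rw [← Real.exp_add]
  refine Real.exp_le_exp.2 ?_
  linarith [sub_le_maxAffine p.1 z.1 hx i, sub_le_maxAffine p.2 z.2 hy j]

/-- Superlevel sets of `U` are bounded modulo `~_⊕`. -/
lemma exists_oplusEquiv_norm_le (ha : ∀ i, 0 < a i) (ha1 : ∑ i, a i = 1) (hb : ∀ j, 0 < b j)
    (hb1 : ∑ j, b j = 1) (c : ℝ) : ∃ M, ∀ p, c ≤ dualU a b x y γ p →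
      ∃ q, OplusEquiv q p ∧ ‖q‖ ≤ M := by
  obtain ⟨c₀, hc₀, hint⟩ := exists_mul_exp_le_integral (n := n) (m := m) (x := x) (y := y) γ
  obtain ⟨C, hC⟩ := exists_sub_mul_exp_le hc₀
  set K := C + linearPart a b x y 0 + 1 - c
  refine ⟨K + ∑ i, K / a i + ∑ j, K / b j, fun p hp => ?_⟩
  obtain ⟨i₀, hi₀⟩ := Finite.exists_max p.1
  obtain ⟨j₀, hj₀⟩ := Finite.exists_max p.2
  have hlin : linearPart a b x y p = linearPart a b x y 0 + (p.1 i₀ + p.2 j₀)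
      - ∑ i, a i * (p.1 i₀ - p.1 i) - ∑ j, b j * (p.2 j₀ - p.2 j) := by
    simp only [linearPart, mul_add, mul_sub, Finset.sum_add_distrib, Finset.sum_sub_distrib,
      ← Finset.sum_mul, ha1, hb1, Prod.fst_zero, Prod.snd_zero, Pi.zero_apply]
    simp
    ring
  have hna : ∀ i, 0 ≤ a i * (p.1 i₀ - p.1 i) := fun i =>
    mul_nonneg (ha i).le (sub_nonneg.2 (hi₀ i))
  have hnb : ∀ j, 0 ≤ b j * (p.2 j₀ - p.2 j) := fun j =>
    mul_nonneg (hb j).le (sub_nonneg.2 (hj₀ j))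
  have hsum : |p.1 i₀ + p.2 j₀| + ∑ i, a i * (p.1 i₀ - p.1 i) + ∑ j, b j * (p.2 j₀ - p.2 j)
      ≤ K := by
    have h1 := hint p i₀ j₀
    have h2 := hC (p.1 i₀ + p.2 j₀)
    rw [dualU, hlin] at hp
    simp only [K]
    linarith
  have hsa := Finset.sum_nonneg fun i (_ : i ∈ Finset.univ) => hna i
  have hsb := Finset.sum_nonneg fun j (_ : j ∈ Finset.univ) => hnb j
  have hs := abs_nonneg (p.1 i₀ + p.2 j₀)
  have hK : 0 ≤ K := by linarith
  have hKa : ∀ i, 0 ≤ K / a i := fun i => div_nonneg hK (ha i).le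
  have hKb : ∀ j, 0 ≤ K / b j := fun j => div_nonneg hK (hb j).le
  have hSa := Finset.sum_nonneg fun i (_ : i ∈ Finset.univ) => hKa i
  have hSb := Finset.sum_nonneg fun j (_ : j ∈ Finset.univ) => hKb j
  have hai : ∀ i, p.1 i₀ - p.1 i ≤ ∑ i, K / a i := fun i => by
    refine le_trans ?_ (Finset.single_le_sum (fun i _ => hKa i) (Finset.mem_univ i))
    rw [le_div_iff₀ (ha i), mul_comm]
    have := Finset.single_le_sum (fun i _ => hna i) (Finset.mem_univ i)
    linarith
  have hbj : ∀ j, p.2 j₀ - p.2 j ≤ ∑ j, K / b j := fun j => by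
    refine le_trans ?_ (Finset.single_le_sum (fun j _ => hKb j) (Finset.mem_univ j))
    rw [le_div_iff₀ (hb j), mul_comm]
    have := Finset.single_le_sum (fun j _ => hnb j) (Finset.mem_univ j)
    linarith
  have hsK : |p.1 i₀ + p.2 j₀| ≤ K := by linarith
  obtain ⟨hs1, hs2⟩ := abs_le.1 hsK
  refine ⟨(fun i => p.1 i - p.1 i₀, fun j => p.2 j + p.1 i₀),
    ⟨-p.1 i₀, fun i => by ring, fun j => by ring⟩, ?_⟩
  have hM : 0 ≤ K + ∑ i, K / a i + ∑ j, K / b j := by linarith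
  refine norm_prod_le_iff.2 ⟨(pi_norm_le_iff_of_nonneg hM).2 fun i => abs_le.2 ⟨?_, ?_⟩,
    (pi_norm_le_iff_of_nonneg hM).2 fun j => abs_le.2 ⟨?_, ?_⟩⟩
  · linarith [hai i]
  · linarith [hi₀ i]
  · linarith [hbj j]
  · linarith [hj₀ j]

lemma continuous_dualFunctional (hF : IsAdmissible x y F) :
    Continuous (dualFunctional a b x y γ F) :=
  (continuous_linearPart.sub (hF.continuous_integral γ)).add continuous_const

omit [Nonempty (Fin n)] [Nonempty (Fin m)] [IsProbabilityMeasure γ] in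
lemma dualFunctional_congr (hF : IsAdmissible x y F) (ha1 : ∑ i, a i = 1)
    (hb1 : ∑ j, b j = 1) {p q : Pot n m} (h : OplusEquiv p q) :
    dualFunctional a b x y γ F p = dualFunctional a b x y γ F q := by
  simp only [dualFunctional, linearPart_congr ha1 hb1 h, hF.congr p q h]

lemma dualFunctional_le_dualU (hF : IsAdmissible x y F) (p : Pot n m) :
    dualFunctional a b x y γ F p ≤ dualU a b x y γ p := by
  have := integral_mono ((isAdmissible_exp x y).integrable γ p) (hF.integrable γ p) (hF.exp_le p)
  simp only [dualFunctional, dualU]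
  linarith

lemma exists_isOptimizer_dualFunctional (hF : IsAdmissible x y F) (ha : ∀ i, 0 < a i)
    (ha1 : ∑ i, a i = 1) (hb : ∀ j, 0 < b j) (hb1 : ∑ j, b j = 1) :
    ∃ p, IsOptimizer (dualFunctional a b x y γ F) p := by
  set G := dualFunctional a b x y γ F
  obtain ⟨M, hM⟩ := exists_oplusEquiv_norm_le (x := x) (y := y) γ ha ha1 hb hb1 (G 0)
  have hred : ∀ p, G 0 ≤ G p → ∃ q ∈ Metric.closedBall (0 : Pot n m) M, G q = G p := by
    intro p hp
    obtain ⟨q, hq, hqM⟩ := hM p (hp.trans (dualFunctional_le_dualU γ hF p))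
    exact ⟨q, by simpa using hqM, dualFunctional_congr γ hF ha1 hb1 hq⟩
  obtain ⟨q₀, hq₀, hq₀G⟩ := hred 0 le_rfl
  obtain ⟨p, -, hp⟩ := (isCompact_closedBall (0 : Pot n m) M).exists_isMaxOn ⟨q₀, hq₀⟩
    (continuous_dualFunctional γ hF).continuousOn
  refine ⟨p, fun q => ?_⟩
  rcases le_total (G q) (G 0) with h | h
  · exact (h.trans hq₀G.ge).trans (hp hq₀)
  · obtain ⟨q', hq', hq'G⟩ := hred q h
    exact hq'G.ge.trans (hp hq')

omit [Nonempty (Fin n)] [Nonempty (Fin m)] in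
lemma IsOptimizer.of_le {G : Pot n m → ℝ} {p q : Pot n m} (hp : IsOptimizer G p)
    (h : G p ≤ G q) : IsOptimizer G q := fun r => (hp r).trans h

/-- Two optimizers force equality in the midpoint convexity of the integrand. -/
lemma ae_midpoint_eq_of_isOptimizer (hF : IsAdmissible x y F)
    (hmid : ∀ p q z, F (midPot p q) z ≤ (F p z + F q z) / 2) {p q : Pot n m}
    (hp : IsOptimizer (dualFunctional a b x y γ F) p)
    (hq : IsOptimizer (dualFunctional a b x y γ F) q) :
    ∀ᵐ z ∂(tilted γ), F (midPot p q) z = (F p z + F q z) / 2 := by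
  have hip := hF.integrable γ p
  have hiq := hF.integrable γ q
  have him := hF.integrable γ (midPot p q)
  have hi : Integrable (fun z => (F p z + F q z) / 2 - F (midPot p q) z) (tilted γ) :=
    ((hip.add hiq).div_const 2).sub him
  have hn : 0 ≤ fun z => (F p z + F q z) / 2 - F (midPot p q) z :=
    fun z => sub_nonneg.2 (hmid p q z)
  have hval : ∫ z, ((F p z + F q z) / 2 - F (midPot p q) z) ∂(tilted γ)
      = (∫ z, F p z ∂(tilted γ) + ∫ z, F q z ∂(tilted γ)) / 2
        - ∫ z, F (midPot p q) z ∂(tilted γ) := by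
    have hadd : Integrable (fun z => (F p z + F q z) / 2) (tilted γ) := (hip.add hiq).div_const 2
    rw [integral_sub hadd him, integral_div, integral_add hip hiq]
  have hzero : ∫ z, ((F p z + F q z) / 2 - F (midPot p q) z) ∂(tilted γ) = 0 := by
    refine le_antisymm ?_ (integral_nonneg hn)
    have h1 := hp (midPot p q)
    have h2 := hq (midPot p q)
    simp only [dualFunctional, linearPart_midPot] at h1 h2
    rw [hval]
    linarith
  filter_upwards [(integral_eq_zero_iff_of_nonneg hn hi).1 hzero] with z hz
  simp only [Pi.zero_apply] at hz
  linarith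

end Existence

section Uniqueness

variable {d n m : ℕ} [Nonempty (Fin n)] [Nonempty (Fin m)]
  {a : Fin n → ℝ} {b : Fin m → ℝ} {x : Fin n → Euc d} {y : Fin m → Euc d}
  (γ : Measure (Euc d × Euc d)) [IsProbabilityMeasure γ]

omit [Nonempty (Fin n)] [Nonempty (Fin m)] in
lemma hasUniqueOptimizer_of_forall {G : Pot n m → ℝ} (hex : ∃ p, IsOptimizer G p)
    (hG : ∀ p q, OplusEquiv p q → G p = G q)
    (h : ∀ p q, IsOptimizer G p → IsOptimizer G q → OplusEquiv p q) : HasUniqueOptimizer G := by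
  obtain ⟨p, hp⟩ := hex
  exact ⟨p, fun q => ⟨fun hq => h q p hq hp, fun hqp => hp.of_le (hG q p hqp).ge⟩⟩

lemma softExp_mul_midpoint_sq_le {l : ℝ} (hl : 0 < l) (p q : Pot n m) (u v : Euc d) :
    (softExp l x (midPot p q).1 u * softExp l y (midPot p q).2 v) ^ 2 ≤
      (softExp l x p.1 u * softExp l y p.2 v) * (softExp l x q.1 u * softExp l y q.2 v) := by
  rw [mul_pow, mul_mul_mul_comm]
  exact mul_le_mul (softExp_midpoint_sq_le x p.1 u hl q.1) (softExp_midpoint_sq_le y p.2 v hl q.2)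
    (sq_nonneg _) (mul_pos (softExp_pos x p.1 u) (softExp_pos x q.1 u)).le

lemma le_half_add_of_sq_le_mul {s t w : ℝ} (hs : 0 < s) (ht : 0 < t) (h : w ^ 2 ≤ s * t) :
    w ≤ (s + t) / 2 :=
  le_of_sq_le_sq (h.trans (by nlinarith [sq_nonneg (s - t)])) (by positivity)

lemma oplusEquiv_of_softExp_midpoint_eq {l : ℝ} (hl : 0 < l) {p q : Pot n m} {u v : Euc d}
    (h : softExp l x (midPot p q).1 u * softExp l y (midPot p q).2 v =
      (softExp l x p.1 u * softExp l y p.2 v + softExp l x q.1 u * softExp l y q.2 v) / 2) :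
    OplusEquiv p q := by
  have hA := softExp_midpoint_sq_le x p.1 u hl q.1
  have hB := softExp_midpoint_sq_le y p.2 v hl q.2
  have hA' := sub_eq_sub_of_softExp_midpoint x p.1 u hl q.1
  have hB' := sub_eq_sub_of_softExp_midpoint y p.2 v hl q.2
  have hle := softExp_mul_midpoint_sq_le (x := x) (y := y) hl p q u v
  have hAm := softExp_pos (l := l) x (midPot p q).1 u
  have hBm := softExp_pos (l := l) y (midPot p q).2 v
  have hA1 := softExp_pos (l := l) x p.1 u
  have hA2 := softExp_pos (l := l) x q.1 u
  have hB1 := softExp_pos (l := l) y p.2 v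
  have hB2 := softExp_pos (l := l) y q.2 v
  change softExp l x (midPot p q).1 u ^ 2 ≤ _ at hA
  change softExp l y (midPot p q).2 v ^ 2 ≤ _ at hB
  change _ ≤ softExp l x (midPot p q).1 u ^ 2 → _ at hA'
  change _ ≤ softExp l y (midPot p q).2 v ^ 2 → _ at hB'
  have heq : softExp l x p.1 u * softExp l y p.2 v = softExp l x q.1 u * softExp l y q.2 v := by
    rw [h] at hle
    nlinarith [sq_nonneg (softExp l x p.1 u * softExp l y p.2 v
      - softExp l x q.1 u * softExp l y q.2 v)]
  have hprod : softExp l x p.1 u * softExp l x q.1 u * (softExp l y p.2 v * softExp l y q.2 v) =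
      softExp l x (midPot p q).1 u ^ 2 * softExp l y (midPot p q).2 v ^ 2 := by
    rw [mul_mul_mul_comm, ← mul_pow, h, ← heq]
    ring
  have hα := hA' (by
    by_contra! hlt
    exact (mul_lt_mul hlt hB (by positivity) (by positivity)).ne' hprod)
  have hβ := hB' (by
    by_contra! hlt
    exact (mul_lt_mul' hA hlt (by positivity) (by positivity)).ne' hprod)
  obtain ⟨i₀⟩ := ‹Nonempty (Fin n)›
  obtain ⟨j₀⟩ := ‹Nonempty (Fin m)›
  have hp1 : p.1 = fun i => q.1 i + (p.1 i₀ - q.1 i₀) := funext fun i => by linarith [hα i i₀]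
  have hp2 : p.2 = fun j => q.2 j + (p.2 j₀ - q.2 j₀) := funext fun j => by linarith [hβ j j₀]
  have : Nonempty (Fin n) := ⟨i₀⟩
  have : Nonempty (Fin m) := ⟨j₀⟩
  have hs : Real.exp ((p.1 i₀ - q.1 i₀) + (p.2 j₀ - q.2 j₀)) = 1 := by
    have e1 := softExp_add_const x q.1 u hl (p.1 i₀ - q.1 i₀)
    have e2 := softExp_add_const y q.2 v hl (p.2 j₀ - q.2 j₀)
    rw [← hp1] at e1
    rw [← hp2] at e2
    rw [e1, e2, mul_mul_mul_comm, ← Real.exp_add] at heq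
    exact (mul_eq_left₀ (mul_pos hA2 hB2).ne').1 heq
  have hs0 := Real.exp_eq_one_iff _ |>.1 hs
  exact ⟨p.1 i₀ - q.1 i₀, fun i => by linarith [hα i i₀], fun j => by linarith [hβ j j₀]⟩

lemma hasUniqueOptimizer_dualUReg (ha : ∀ i, 0 < a i) (ha1 : ∑ i, a i = 1) (hb : ∀ j, 0 < b j)
    (hb1 : ∑ j, b j = 1) {l : ℝ} (hl : 0 < l) :
    HasUniqueOptimizer (dualUReg l a b x y γ) := by
  have hF := isAdmissible_softExp x y hl
  refine hasUniqueOptimizer_of_forall (exists_isOptimizer_dualFunctional γ hF ha ha1 hb hb1)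
    (fun p q => dualFunctional_congr γ hF ha1 hb1) fun p q hp hq => ?_
  have := ae_midpoint_eq_of_isOptimizer γ hF (fun p q z => le_half_add_of_sq_le_mul
    (hF.pos p z) (hF.pos q z) (softExp_mul_midpoint_sq_le hl p q z.1 z.2)) hp hq
  have : NeZero (tilted γ) := ⟨tilted_ne_zero γ⟩
  obtain ⟨z, hz⟩ := ‹∀ᵐ z ∂(tilted γ), _›.exists
  exact oplusEquiv_of_softExp_midpoint_eq hl hz

lemma exp_maxAffine_midpoint_sq_le (p q : Pot n m) (u v : Euc d) :
    Real.exp (maxAffine x (midPot p q).1 u + maxAffine y (midPot p q).2 v) ^ 2 ≤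
      Real.exp (maxAffine x p.1 u + maxAffine y p.2 v) *
        Real.exp (maxAffine x q.1 u + maxAffine y q.2 v) := by
  rw [← Real.exp_add, ← Real.exp_nat_mul]
  refine Real.exp_le_exp.2 ?_
  have h1 := maxAffine_midpoint_le x p.1 u q.1
  have h2 := maxAffine_midpoint_le y p.2 v q.2
  simp only [midPot]
  push_cast
  linarith

lemma ae_maxAffine_add_eq {p q : Pot n m} (hp : IsOptimizer (dualU a b x y γ) p)
    (hq : IsOptimizer (dualU a b x y γ) q) :
    ∀ᵐ z ∂γ, maxAffine x p.1 z.1 + maxAffine y p.2 z.2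
      = maxAffine x q.1 z.1 + maxAffine y q.2 z.2 := by
  have hF := isAdmissible_exp x y
  refine ae_of_ae_tilted γ ?_
  filter_upwards [ae_midpoint_eq_of_isOptimizer γ hF (fun p q z => le_half_add_of_sq_le_mul
    (hF.pos p z) (hF.pos q z) (exp_maxAffine_midpoint_sq_le p q z.1 z.2)) hp hq] with z hz
  have hle := exp_maxAffine_midpoint_sq_le (x := x) (y := y) p q z.1 z.2
  rw [hz] at hle
  refine Real.exp_injective ?_
  nlinarith [sq_nonneg (Real.exp (maxAffine x p.1 z.1 + maxAffine y p.2 z.2)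
    - Real.exp (maxAffine x q.1 z.1 + maxAffine y q.2 z.2))]

lemma eqOn_of_ae_eq {X Y : Type*} [TopologicalSpace X] [MeasurableSpace X] [TopologicalSpace Y]
    [T2Space Y] {μ : Measure X} {G : Set X} (hG : IsOpen G)
    (hpos : ∀ V ⊆ G, IsOpen V → V.Nonempty → 0 < μ V) {f g : X → Y} (hf : Continuous f)
    (hg : Continuous g) (h : ∀ᵐ z ∂μ, f z = g z) : Set.EqOn f g G := by
  intro z hz
  by_contra hne
  refine (hpos (G ∩ {z | f z ≠ g z}) Set.inter_subset_left
    (hG.inter (isOpen_ne_fun hf hg)) ⟨z, hz, hne⟩).ne' ?_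
  exact measure_mono_null Set.inter_subset_right h

/-- On a connected open subset of a product, `D(x) = E(y)` forces `D` to be constant. -/
lemma eq_of_isPreconnected_prod {X Y Z : Type*} [TopologicalSpace X] [TopologicalSpace Y]
    [TopologicalSpace Z] [T2Space Z] {G : Set (X × Y)} (hG : IsOpen G) (hc : IsPreconnected G)
    {D : X → Z} {E : Y → Z} (hD : Continuous D) (h : ∀ z ∈ G, D z.1 = E z.2) {z w : X × Y}
    (hz : z ∈ G) (hw : w ∈ G) : D w.1 = D z.1 := by
  by_contra hne
  have hopen : IsOpen {t | t ∈ G ∧ D t.1 = D z.1} := by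
    rw [isOpen_iff_mem_nhds]
    rintro t ⟨ht, htz⟩
    have h1 : ∀ᶠ s in 𝓝 t, (s.1, t.2) ∈ G :=
      (Continuous.continuousAt (f := fun s : X × Y => (s.1, t.2)) (by fun_prop)).eventually
        (hG.mem_nhds ht)
    filter_upwards [h1, hG.mem_nhds ht] with s hs1 hs2
    exact ⟨hs2, (h _ hs1).trans ((h _ ht).symm.trans htz)⟩
  have hopen' : IsOpen {t : X × Y | D t.1 ≠ D z.1} :=
    isOpen_ne_fun (hD.comp continuous_fst) continuous_const
  obtain ⟨t, -, ⟨-, ht1⟩, ht2⟩ := hc _ _ hopen hopen'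
    (fun t ht => (em (D t.1 = D z.1)).imp (fun h => ⟨ht, h⟩) id) ⟨z, hz, hz, rfl⟩ ⟨w, hw, hne⟩
  exact ht2 ht1

omit [IsProbabilityMeasure γ] in
/-- If the maxima of affine functions of an optimizer dominate those of `q` almost everywhere,
then the optimizer dominates `q`. -/
lemma le_of_isOptimizer_dualU (ha : ∀ i, 0 < a i) (hb : ∀ j, 0 < b j) {p q : Pot n m}
    (hp : IsOptimizer (dualU a b x y γ) p)
    (h : ∀ᵐ z ∂γ, maxAffine x q.1 z.1 ≤ maxAffine x p.1 z.1 ∧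
      maxAffine y q.2 z.2 ≤ maxAffine y p.2 z.2) : q ≤ p := by
  have hopt := hp (p ⊔ q)
  have hint : ∫ z, Real.exp (maxAffine x (p ⊔ q).1 z.1 + maxAffine y (p ⊔ q).2 z.2) ∂(tilted γ)
      = ∫ z, Real.exp (maxAffine x p.1 z.1 + maxAffine y p.2 z.2) ∂(tilted γ) := by
    refine integral_congr_ae ?_
    filter_upwards [(withDensity_absolutelyContinuous γ _).ae_le h] with z hz
    have e1 := maxAffine_max x p.1 z.1 q.1
    have e2 := maxAffine_max y p.2 z.2 q.2
    rw [max_eq_left hz.1] at e1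
    rw [max_eq_left hz.2] at e2
    change Real.exp (maxAffine x (fun i => max (p.1 i) (q.1 i)) z.1
      + maxAffine y (fun j => max (p.2 j) (q.2 j)) z.2) = _
    rw [e1, e2]
  have hA : ∀ i, 0 ≤ a i * ((p ⊔ q).1 i - p.1 i) := fun i =>
    mul_nonneg (ha i).le (sub_nonneg.2 (le_max_left _ _))
  have hB : ∀ j, 0 ≤ b j * ((p ⊔ q).2 j - p.2 j) := fun j =>
    mul_nonneg (hb j).le (sub_nonneg.2 (le_max_left _ _))
  have hsum : ∑ i, a i * ((p ⊔ q).1 i - p.1 i) + ∑ j, b j * ((p ⊔ q).2 j - p.2 j) ≤ 0 := by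
    simp only [dualU, hint, linearPart, mul_add, Finset.sum_add_distrib] at hopt
    simp only [mul_sub, Finset.sum_sub_distrib]
    linarith
  have hsA := Finset.sum_nonneg fun i (_ : i ∈ Finset.univ) => hA i
  have hsB := Finset.sum_nonneg fun j (_ : j ∈ Finset.univ) => hB j
  refine ⟨fun i => ?_, fun j => ?_⟩
  · have h1 := (Finset.single_le_sum (fun i _ => hA i) (Finset.mem_univ i)).trans
      (show _ ≤ 0 by linarith)
    have h2 := nonpos_of_mul_nonpos_right h1 (ha i)
    exact (le_max_right (p.1 i) (q.1 i)).trans (sub_nonpos.1 h2)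
  · have h1 := (Finset.single_le_sum (fun j _ => hB j) (Finset.mem_univ j)).trans
      (show _ ≤ 0 by linarith)
    have h2 := nonpos_of_mul_nonpos_right h1 (hb j)
    exact (le_max_right (p.2 j) (q.2 j)).trans (sub_nonpos.1 h2)

lemma oplusEquiv_of_isOptimizer_dualU (ha : ∀ i, 0 < a i) (ha1 : ∑ i, a i = 1)
    (hb : ∀ j, 0 < b j) (hb1 : ∑ j, b j = 1) (hγ : HasConnectedOpenCarrier γ) {p q : Pot n m}
    (hp : IsOptimizer (dualU a b x y γ) p) (hq : IsOptimizer (dualU a b x y γ) q) :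
    OplusEquiv p q := by
  obtain ⟨G, hGo, hGc, hGnull, hpos⟩ := hγ
  have hcx : ∀ α : Fin n → ℝ, Continuous (maxAffine x α) := fun α =>
    (continuous_maxAffine x).comp (Continuous.prodMk_right α)
  have hcy : ∀ β : Fin m → ℝ, Continuous (maxAffine y β) := fun β =>
    (continuous_maxAffine y).comp (Continuous.prodMk_right β)
  have heq : ∀ z ∈ G, maxAffine x p.1 z.1 + maxAffine y p.2 z.2
      = maxAffine x q.1 z.1 + maxAffine y q.2 z.2 := fun z hz =>
    eqOn_of_ae_eq hGo hpos (((hcx _).comp continuous_fst).add ((hcy _).comp continuous_snd))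
      (((hcx _).comp continuous_fst).add ((hcy _).comp continuous_snd))
      (ae_maxAffine_add_eq γ hp hq) hz
  obtain ⟨z₀, hz₀⟩ := hGc.nonempty
  set c := maxAffine x p.1 z₀.1 - maxAffine x q.1 z₀.1
  have hconst : ∀ z ∈ G, maxAffine x p.1 z.1 - maxAffine x q.1 z.1 = c := fun z hz =>
    eq_of_isPreconnected_prod hGo hGc.isPreconnected
      (D := fun u => maxAffine x p.1 u - maxAffine x q.1 u)
      (E := fun v => maxAffine y q.2 v - maxAffine y p.2 v) ((hcx _).sub (hcx _))
      (fun z hz => by linarith [heq z hz]) hz₀ hz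
  set q' : Pot n m := (fun i => q.1 i + c, fun j => q.2 j + -c)
  have hqq' : OplusEquiv q' q := ⟨c, fun i => rfl, fun j => (sub_eq_add_neg _ _).symm⟩
  have hq' : IsOptimizer (dualU a b x y γ) q' :=
    hq.of_le (dualFunctional_congr γ (isAdmissible_exp x y) ha1 hb1 hqq').ge
  have hae : ∀ᵐ z ∂γ, maxAffine x p.1 z.1 = maxAffine x q'.1 z.1 ∧
      maxAffine y p.2 z.2 = maxAffine y q'.2 z.2 := by
    filter_upwards [show ∀ᵐ z ∂γ, z ∈ G from hGnull] with z hz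
    simp only [q', maxAffine_add_const]
    constructor <;> linarith [hconst z hz, heq z hz]
  have hpq : p = q' := le_antisymm
    (le_of_isOptimizer_dualU γ ha hb hq' (hae.mono fun z hz => ⟨hz.1.le, hz.2.le⟩))
    (le_of_isOptimizer_dualU γ ha hb hp (hae.mono fun z hz => ⟨hz.1.ge, hz.2.ge⟩))
  rwa [hpq]

end Uniqueness

section Convergence

variable {d n m : ℕ} [Nonempty (Fin n)] [Nonempty (Fin m)]
  {a : Fin n → ℝ} {b : Fin m → ℝ} {x : Fin n → Euc d} {y : Fin m → Euc d}
  (γ : Measure (Euc d × Euc d)) [IsProbabilityMeasure γ]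

lemma tendsto_rpow_inv_atTop {c : ℝ} (hc : c ≠ 0) :
    Tendsto (fun l : ℝ => c ^ (1 / l)) atTop (𝓝 1) := by
  have h : Tendsto (fun l : ℝ => 1 / l) atTop (𝓝 0) := by
    simpa using tendsto_inv_atTop_zero (𝕜 := ℝ)
  simpa using (tendsto_const_nhds (x := c)).rpow h (Or.inl hc)

lemma tendsto_dualUReg (p : Pot n m) :
    Tendsto (fun l => dualUReg l a b x y γ p) atTop (𝓝 (dualU a b x y γ p)) := by
  refine Tendsto.add_const _ (Tendsto.const_sub _ ?_)
  set I := ∫ z, Real.exp (maxAffine x p.1 z.1 + maxAffine y p.2 z.2) ∂(tilted γ)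
  have hI := (isAdmissible_exp x y).integrable γ p
  have hn : (n : ℝ) ≠ 0 := by
    exact_mod_cast (Fin.pos_iff_nonempty.2 ‹Nonempty (Fin n)›).ne'
  have hm : (m : ℝ) ≠ 0 := by
    exact_mod_cast (Fin.pos_iff_nonempty.2 ‹Nonempty (Fin m)›).ne'
  have hlim : Tendsto (fun l : ℝ => (n : ℝ) ^ (1 / l) * (m : ℝ) ^ (1 / l) * I) atTop (𝓝 I) := by
    simpa using ((tendsto_rpow_inv_atTop hn).mul (tendsto_rpow_inv_atTop hm)).mul_const I
  refine tendsto_of_tendsto_of_tendsto_of_le_of_le' tendsto_const_nhds hlim ?_ ?_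
  · filter_upwards [eventually_gt_atTop 0] with l hl
    have hF := isAdmissible_softExp x y hl
    exact integral_mono hI (hF.integrable γ p) (hF.exp_le p)
  · filter_upwards [eventually_gt_atTop 0] with l hl
    rw [← integral_const_mul]
    exact integral_mono ((isAdmissible_softExp x y hl).integrable γ p) (hI.const_mul _)
      fun z => softExp_mul_le x y hl p z.1 z.2

lemma eventually_exists_isOptimizer_near (ha : ∀ i, 0 < a i) (ha1 : ∑ i, a i = 1)
    (hb : ∀ j, 0 < b j) (hb1 : ∑ j, b j = 1) {p₀ : Pot n m}
    (hp₀ : IsOptimizer (dualU a b x y γ) p₀) {ε : ℝ} (hε : 0 < ε) :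
    ∀ᶠ l : ℝ in atTop, ∀ p, IsOptimizer (dualUReg l a b x y γ) p →
      ∃ q, IsOptimizer (dualU a b x y γ) q ∧ oplusNorm (p - q) < ε := by
  have hE := isAdmissible_exp x y
  set U := dualU a b x y γ
  obtain ⟨M, hM⟩ := exists_oplusEquiv_norm_le (x := x) (y := y) γ ha ha1 hb hb1 (U p₀ - 1)
  set B : Set (Pot n m) := Metric.closedBall 0 M ∩
    ⋂ q, ⋂ (_ : IsOptimizer U q), {p | ε ≤ oplusNorm (p - q)}
  have hB : IsCompact B := (isCompact_closedBall _ _).inter_right <|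
    isClosed_iInter fun q => isClosed_iInter fun _ =>
      isClosed_le continuous_const (continuous_oplusNorm.comp (continuous_id.sub continuous_const))
  have hgap : ∃ c < U p₀, ∀ p ∈ B, U p ≤ c := by
    rcases B.eq_empty_or_nonempty with hem | hne
    · exact ⟨U p₀ - 1, by linarith, by simp [hem]⟩
    · obtain ⟨r, hr, hmax⟩ := hB.exists_isMaxOn hne (continuous_dualFunctional γ hE).continuousOn
      refine ⟨U r, lt_of_not_ge fun hge => ?_, fun p hp => hmax hp⟩
      have := Set.mem_iInter₂.1 hr.2 r (hp₀.of_le hge)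
      simp only [sub_self, Set.mem_ofPred_eq, oplusNorm_zero] at this
      linarith
  obtain ⟨c, hc, hcB⟩ := hgap
  have hlim := tendsto_dualUReg (a := a) (b := b) (x := x) (y := y) γ p₀
  filter_upwards [eventually_gt_atTop 0, hlim.eventually (lt_mem_nhds hc),
    hlim.eventually (lt_mem_nhds (sub_one_lt (U p₀)))] with l hl h1 h2 p hp
  have hUp : dualUReg l a b x y γ p₀ ≤ U p :=
    (hp p₀).trans (dualFunctional_le_dualU γ (isAdmissible_softExp x y hl) p)
  obtain ⟨r, hrp, hrM⟩ := hM p (h2.le.trans hUp)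
  have hUr : U r = U p := dualFunctional_congr γ hE ha1 hb1 hrp
  by_contra! hfar
  refine (hcB r ⟨by simpa using hrM, Set.mem_iInter₂.2 fun q hq => ?_⟩).not_gt
    (by rw [hUr]; exact h1.trans_le hUp)
  change ε ≤ oplusNorm (r - q)
  rw [hrp.oplusNorm_sub (OplusEquiv.refl q)]
  exact hfar q hq

end Convergence

end SemiDiscrete

theorem proposition6p2 {d n m : ℕ}
    (a : Fin n → ℝ) (b : Fin m → ℝ) (x : Fin n → Euc d) (y : Fin m → Euc d)
    (γ : Measure (Euc d × Euc d)) [IsProbabilityMeasure γ]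
    (ha : ∀ i, 0 < a i) (ha1 : ∑ i, a i = 1)
    (hb : ∀ j, 0 < b j) (hb1 : ∑ j, b j = 1)
    (hγ : γ ≪ volume) :
    -- the regularized problem has a unique optimizer modulo `~_⊕`
    (∀ l : ℝ, 0 < l → HasUniqueOptimizer (dualUReg l a b x y γ)) ∧
    -- the dual problem has an optimizer, and its set of optimizers attracts those of `U_l`
    ((∃ p, IsOptimizer (dualU a b x y γ) p) ∧
      ∀ ε : ℝ, 0 < ε → ∀ᶠ l : ℝ in atTop, ∀ p, IsOptimizer (dualUReg l a b x y γ) p →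
        ∃ q, IsOptimizer (dualU a b x y γ) q ∧ oplusNorm (p - q) < ε) ∧
    -- if `γ` has a connected open carrier, the dual optimizer is unique modulo `~_⊕` and
    -- the regularized optimizers converge to it
    (HasConnectedOpenCarrier γ →
      HasUniqueOptimizer (dualU a b x y γ) ∧
      ∀ pstar : Pot n m, IsOptimizer (dualU a b x y γ) pstar →
        ∀ P : ℝ → Pot n m, (∀ l : ℝ, 0 < l → IsOptimizer (dualUReg l a b x y γ) (P l)) →
          Tendsto (fun l => oplusNorm (P l - pstar)) atTop (𝓝 0)) := by
  have : Nonempty (Fin n) := by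
    by_contra hn
    rw [not_nonempty_iff] at hn
    simp at ha1
  have : Nonempty (Fin m) := by
    by_contra hm
    rw [not_nonempty_iff] at hm
    simp at hb1
  have hE := isAdmissible_exp x y
  have hex : ∃ p, IsOptimizer (dualU a b x y γ) p :=
    exists_isOptimizer_dualFunctional γ hE ha ha1 hb hb1
  obtain ⟨p₀, hp₀⟩ := hex
  refine ⟨fun l hl => hasUniqueOptimizer_dualUReg γ ha ha1 hb hb1 hl, ⟨⟨p₀, hp₀⟩, fun ε hε =>
    eventually_exists_isOptimizer_near γ ha ha1 hb hb1 hp₀ hε⟩, fun hG => ⟨?_, ?_⟩⟩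
  · exact hasUniqueOptimizer_of_forall ⟨p₀, hp₀⟩
      (fun p q => dualFunctional_congr γ hE ha1 hb1)
      fun p q hp hq => oplusEquiv_of_isOptimizer_dualU γ ha ha1 hb hb1 hG hp hq
  · intro pstar hpstar P hP
    rw [Metric.tendsto_nhds]
    intro ε hε
    filter_upwards [eventually_gt_atTop 0,
      eventually_exists_isOptimizer_near γ ha ha1 hb hb1 hp₀ hε] with l hl h
    obtain ⟨q, hq, hlt⟩ := h (P l) (hP l hl)
    rw [Real.dist_eq, sub_zero, abs_of_nonneg (oplusNorm_nonneg _),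
      (OplusEquiv.refl (P l)).oplusNorm_sub
        (oplusEquiv_of_isOptimizer_dualU γ ha ha1 hb hb1 hG hpstar hq)]
    exact hlt
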